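/- Let $\mathbb D$ be the open unit disk. For a complex-valued harmonic function $f=h+\overline g$ on $\mathbb D$ with $f(0)=0$, where $h(z)=\sum_{n\ge1}a_nz^n$ and $g(z)=\sum_{n\ge1}b_nz^n$ are analytic in $\mathbb D$, call $f$ locally univalent (meaning locally one-to-one and sense-preserving) if $|g'(z)|<|h'(z)|$ for all $z\in\mathbb D$. Let $S_H^O$ be the class of univalent, sense-preserving harmonic functions $f$ on $\mathbb D$ with $f(0)=0$, $f_z(0)=1$, $f_{\bar z}(0)=0$. For real $\gamma$ let $H_\gamma=\{w\in\mathbb C:\operatorname{Re}(e^{i\gamma}w)>-\tfrac12\}$, and let $S^0(H_\gamma)$ be the class of those $f\in S_H^O$ with $f(\mathbb D)=H_\gamma$. The harmonic convolution of $f=\sum_{n\ge1}a_nz^n+\overline{\sum_{n\ge1}b_nz^n}$ and $F=\sum_{n\ge1}A_nz^n+\overline{\sum_{n\ge1}B_nz^n}$ is $f*F=\sum_{n\ge1}a_nA_nz^n+\overline{\sum_{n\ge1}b_nB_nz^n}$. **Theorem 2.** Let $\gamma_1,\gamma_2\in\mathbb R$ and $f_k\in S^0(H_{\gamma_k})$ for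 $k=1,2$. If $f_1*f_2$ is locally univalent in $\mathbb D$, then $f_1*f_2\in S_H^O$ (in particular it is univalent in $\mathbb D$) and $f_1*f_2$ is convex in the direction $-(\gamma_1+\gamma_2)$, that is, every line parallel to $e^{-i(\gamma_1+\gamma_2)}$ meets $(f_1*f_2)(\mathbb D)$ in a connected or empty set. -/

import Mathlib

open Complex Metric ComplexConjugate

namespace HarmonicMaps

noncomputable section

/-- The Wirtinger derivative `f_z = (f_x - i f_y) / 2`. -/
def dz (f : ℂ → ℂ) (z : ℂ) : ℂ :=
  (fderiv ℝ f z 1 - I * fderiv ℝ f z I) / 2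

/-- The Wirtinger derivative `f_z̄ = (f_x + i f_y) / 2`. -/
def dzbar (f : ℂ → ℂ) (z : ℂ) : ℂ :=
  (fderiv ℝ f z 1 + I * fderiv ℝ f z I) / 2

/-- A harmonic function `f = h + conj g` on the unit disk is called locally univalent (locally
one-to-one and sense-preserving) if `|g'| < |h'|` on the disk. Here `f_z = h'` and
`f_z̄ = conj g'`, so this says that the Jacobian `|f_z|² - |f_z̄|²` is positive. -/
def LocallyUnivalent (f : ℂ → ℂ) : Prop :=
  ∀ z ∈ ball (0 : ℂ) 1, ‖dzbar f z‖ < ‖dz f z‖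

/-- The class `S_H^O`: harmonic, sense-preserving, univalent functions on the unit disk with
`f(0) = 0`, `f_z(0) = 1`, `f_z̄(0) = 0`. -/
structure IsSHO (f : ℂ → ℂ) : Prop where
  harmonic : InnerProductSpace.HarmonicOnNhd f (ball (0 : ℂ) 1)
  sensePreserving : LocallyUnivalent f
  univalent : Set.InjOn f (ball (0 : ℂ) 1)
  map_zero : f 0 = 0
  dz_zero : dz f 0 = 1
  dzbar_zero : dzbar f 0 = 0

/-- The slanted half-plane `H_γ = {w : Re (e^{iγ} w) > -1/2}`. -/
def slantedHalfPlane (γ : ℝ) : Set ℂ :=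
  {w | -(1 / 2 : ℝ) < (exp (I * γ) * w).re}

/-- The class `S⁰(H_γ)` of those `f` in `S_H^O` that map the unit disk onto `H_γ`. -/
def IsSHOOnto (γ : ℝ) (f : ℂ → ℂ) : Prop :=
  IsSHO f ∧ f '' ball (0 : ℂ) 1 = slantedHalfPlane γ

/-- The coefficient `a_n` (`n ≥ 1`) in
`f(z) = f(0) + ∑_{n ≥ 1} a_n z^n + ∑_{n ≥ 1} conj (b_n z^n)`. -/
def coeffA (f : ℂ → ℂ) (n : ℕ) : ℂ :=
  dz^[n] f 0 / (n.factorial : ℂ)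

/-- The coefficient `b_n` (`n ≥ 1`) in
`f(z) = f(0) + ∑_{n ≥ 1} a_n z^n + ∑_{n ≥ 1} conj (b_n z^n)`. -/
def coeffB (f : ℂ → ℂ) (n : ℕ) : ℂ :=
  conj (dzbar^[n] f 0 / (n.factorial : ℂ))

/-- The harmonic convolution
`(f * F)(z) = ∑_{n ≥ 1} a_n A_n z^n + conj (∑_{n ≥ 1} b_n B_n z^n)` of harmonic functions on the
unit disk that vanish at `0`. -/
def harmonicConv (f F : ℂ → ℂ) (z : ℂ) : ℂ :=
  (∑' n : ℕ, coeffA f (n + 1) * coeffA F (n + 1) * z ^ (n + 1)) +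
    conj (∑' n : ℕ, coeffB f (n + 1) * coeffB F (n + 1) * z ^ (n + 1))

/-- A set is convex in the direction `θ` if its intersection with every line parallel to `e^{iθ}`
is connected or empty. -/
def ConvexInDirection (θ : ℝ) (S : Set ℂ) : Prop :=
  ∀ w : ℂ, IsPreconnected (S ∩ Set.range fun t : ℝ => w + t * exp (I * θ))

end

end HarmonicMaps

namespace HarmonicMaps

/-! Write `f_k = h_k + conj g_k`, `c_k = e^{iγ_k}` and `c = c₁c₂`. Since `|c_k| = 1`, the analytic
function `c_k h_k + c_k⁻¹ g_k` has the same real part as `c_k f_k`. It therefore maps the disk into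
`Re w > -1/2`, and the normalization at `0` gives equality in the Schwarz lemma: it equals `c_k z /
(1 - c_k z)`. Its coefficients are known, so convolving with it is just a rotation, and `2(AA' -
BB') = (A + B)(A' - B') + (A - B)(A' + B')` expresses `cH - c⁻¹G`, for the convolution `H + conj G`,
through rotated copies of `c_k h_k - c_k⁻¹ g_k` (`hasSum_mul_sub_mul`). Dilatations of modulus below
one then make `c⁻¹(1 - cz)²(cH' - c⁻¹G')` have positive real part (`re_deriv_conv_pos`).

The substitution `w = (1 + cz)/(1 - cz)` turns this into `Re L' > 0` on the right half-plane, where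
`L = A - B`, `A = cH`, `B = c⁻¹G`. Shearing now applies: `A + conj B = c f` has the same imaginary
part as `L`, so horizontal slices of its image are images of the level sets of `Im L`. These are
connected (`level_isPreconnected`), which gives directional convexity. Along each of them `Re (A +
B)` increases with `Re L` because `|B'| < |A'|`, which gives univalence
(`injOn_add_conj_of_re_pos`). -/

/-! ### Schwarz–Pick estimates for positive real part. -/

theorem cayley_re_pos {s : ℝ} (hs : 0 < s) (t : ℝ) {ζ : ℂ} (hζ : ‖ζ‖ < 1) :
    0 < (s * (1 + ζ) / (1 - ζ) + t * I).re := by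
  have hne : 1 - ζ ≠ 0 := fun h => by
    have : ζ = 1 := (sub_eq_zero.mp h).symm
    simp [this] at hζ
  have h1 : 0 < normSq (1 - ζ) := normSq_pos.mpr hne
  have h2 : normSq ζ < 1 := by
    rw [normSq_eq_norm_sq]; nlinarith [norm_nonneg ζ]
  have : (s * (1 + ζ) / (1 - ζ) + t * I).re = s * (1 - normSq ζ) / normSq (1 - ζ) := by
    simp only [add_re, div_re, mul_re, mul_im, ofReal_re, ofReal_im, I_re, I_im, add_im, one_re,
      one_im, sub_re, sub_im]
    rw [normSq_apply ζ]
    field_simp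
    ring
  rw [this]
  have : 0 < 1 - normSq ζ := by linarith
  positivity

theorem norm_sub_div_add_conj_lt_one {p q : ℂ} (hp : 0 < p.re) (hq : 0 < q.re) :
    ‖(p - q) / (p + conj q)‖ < 1 := by
  have hne : p + conj q ≠ 0 := fun h => by
    have := congrArg re h
    simp at this
    linarith
  rw [norm_div, div_lt_one (norm_pos_iff.mpr hne)]
  apply lt_of_pow_lt_pow_left₀ 2 (norm_nonneg _)
  rw [← normSq_eq_norm_sq, ← normSq_eq_norm_sq, normSq_apply, normSq_apply]
  simp
  nlinarith [mul_pos hp hq]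

/-- A consequence of the Schwarz–Pick lemma for functions with positive real part on the right
half-plane. -/
theorem norm_sub_le_of_re_pos {P : ℂ → ℂ} (hP : DifferentiableOn ℂ P {w | 0 < w.re})
    (hpos : ∀ w : ℂ, 0 < w.re → 0 < (P w).re) {a s σ : ℝ} (ha : 0 < a) (hs : a ≤ s) (hσ : a ≤ σ)
    (t : ℝ) :
    ‖P (σ + t * I) - P (s + t * I)‖ ≤ |σ - s| / a * (P (s + t * I)).re := by
  have hs0 : 0 < s := ha.trans_le hs
  -- Cayley map of the disk into the right half-plane with `W 0 = s + tI`; the real point `(σ -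
  -- s)/(σ + s)` goes to `σ + tI`.
  set W : ℂ → ℂ := fun ζ => s * (1 + ζ) / (1 - ζ) + t * I with hW
  set p₀ := P (s + t * I) with hp₀
  have hp₀pos : 0 < p₀.re := hpos _ (by simpa using hs0)
  have hWpos : ∀ ζ ∈ ball (0 : ℂ) 1, 0 < (W ζ).re := fun ζ hζ =>
    cayley_re_pos hs0 t (by simpa using hζ)
  have hne : ∀ ζ ∈ ball (0 : ℂ) 1, 1 - ζ ≠ 0 := fun ζ hζ h => by
    have : ζ = 1 := (sub_eq_zero.mp h).symm
    simp [this] at hζ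
  have hWd : DifferentiableOn ℂ W (ball 0 1) := by
    intro ζ hζ
    refine DifferentiableAt.differentiableWithinAt ?_
    have := hne ζ hζ
    fun_prop (disch := assumption)
  have hPW : DifferentiableOn ℂ (fun ζ => P (W ζ)) (ball 0 1) := hP.comp hWd hWpos
  have hden : ∀ ζ ∈ ball (0 : ℂ) 1, P (W ζ) + conj p₀ ≠ 0 := fun ζ hζ h => by
    have h1 := congrArg re h
    have h2 := hpos _ (hWpos ζ hζ)
    simp at h1
    linarith
  have hQ : DifferentiableOn ℂ (fun ζ => (P (W ζ) - p₀) / (P (W ζ) + conj p₀)) (ball 0 1) :=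
    (hPW.sub_const _).div (hPW.add_const _) hden
  have hρ : ‖(((σ - s) / (σ + s) : ℝ) : ℂ)‖ = |σ - s| / (σ + s) := by
    rw [norm_real, Real.norm_eq_abs, abs_div, abs_of_pos (by linarith : 0 < σ + s)]
  have hρ1 : |σ - s| / (σ + s) < 1 := by
    rw [div_lt_one (by linarith), abs_lt]; constructor <;> linarith
  have key := norm_le_norm_of_mapsTo_ball (z := (((σ - s) / (σ + s) : ℝ) : ℂ)) hQ
    (fun ζ hζ => by
      simpa using (norm_sub_div_add_conj_lt_one (hpos _ (hWpos ζ hζ)) hp₀pos).le)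
    (by simp [hW, hp₀]) (by rwa [hρ])
  have hWσ : W (((σ - s) / (σ + s) : ℝ) : ℂ) = σ + t * I := by
    have h1 : (σ + s : ℂ) ≠ 0 := by exact_mod_cast (by linarith : σ + s ≠ 0)
    have h2 : (s : ℂ) ≠ 0 := by exact_mod_cast hs0.ne'
    have h3 : (1 - ((σ - s) / (σ + s) : ℂ)) ≠ 0 := by
      rw [one_sub_div h1]
      refine div_ne_zero ?_ h1
      ring_nf
      exact mul_ne_zero h2 (by norm_num)
    simp only [hW, add_left_inj]
    push_cast
    rw [div_eq_iff h3]
    field_simp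
    ring
  rw [hWσ, hρ, norm_div] at key
  have hσmem : P (σ + t * I) + conj p₀ ≠ 0 := by
    have h := hden _ (show (((σ - s) / (σ + s) : ℝ) : ℂ) ∈ ball (0 : ℂ) 1 by
      rw [mem_ball_zero_iff, hρ]; exact hρ1)
    rwa [hWσ] at h
  rw [div_le_div_iff₀ (norm_pos_iff.mpr hσmem) (by linarith)] at key
  have htri : ‖P (σ + t * I) + conj p₀‖ ≤ ‖P (σ + t * I) - p₀‖ + 2 * p₀.re := by
    have : P (σ + t * I) + conj p₀ = (P (σ + t * I) - p₀) + ((2 * p₀.re : ℝ) : ℂ) := by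
      rw [← add_conj]; ring
    rw [this]
    refine (norm_add_le _ _).trans_eq ?_
    rw [norm_real, Real.norm_eq_abs, abs_of_pos (by linarith)]
  -- The right side is `2 min σ s`, the denominator left after solving `key` and `htri` for `‖P (σ +
  -- t * I) - p₀‖`.
  have h2a : 2 * a ≤ σ + s - |σ - s| := by
    rcases abs_cases (σ - s) with h | h <;> linarith
  have hk := mul_le_mul_of_nonneg_left htri (abs_nonneg (σ - s))
  have := norm_nonneg (P (σ + t * I) - p₀)
  rw [div_mul_eq_mul_div, le_div_iff₀ ha]
  nlinarith

/-! ### Level sets of `Im L` when `Re L' > 0`. -/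

theorem hasDerivAt_im_vertical {L : ℂ → ℂ} (hL : DifferentiableOn ℂ L {w | 0 < w.re}) {s : ℝ}
    (hs : 0 < s) (t : ℝ) :
    HasDerivAt (fun t : ℝ => (L (s + t * I)).im) (deriv L (s + t * I)).re t := by
  have hd : HasDerivAt L (deriv L (s + t * I)) (s + t * I) :=
    (hL.differentiableAt ((isOpen_lt continuous_const continuous_re).mem_nhds
      (by simpa using hs))).hasDerivAt
  have h1 : HasDerivAt (fun t : ℝ => (s : ℂ) + t * I) I t := by
    simpa using (((hasDerivAt_id t).ofReal_comp).mul_const I).const_add (s : ℂ)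
  have h2 := hd.comp t h1
  have h3 := (imCLM.hasFDerivAt).comp_hasDerivAt t h2
  convert! h3 using 1
  simp

theorem strictMono_im_vertical {L : ℂ → ℂ} (hL : DifferentiableOn ℂ L {w | 0 < w.re})
    (hpos : ∀ w : ℂ, 0 < w.re → 0 < (deriv L w).re) {s : ℝ} (hs : 0 < s) :
    StrictMono fun t : ℝ => (L (s + t * I)).im :=
  strictMono_of_hasDerivAt_pos (fun t => hasDerivAt_im_vertical hL hs t)
    fun t => hpos _ (by simpa using hs)

/-- First-order expansion along horizontal segments. -/
theorem norm_sub_sub_le_horizontal {L : ℂ → ℂ} (hL : DifferentiableOn ℂ L {w | 0 < w.re})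
    (hpos : ∀ w : ℂ, 0 < w.re → 0 < (deriv L w).re) {a s σ : ℝ} (ha : 0 < a) (hs : a ≤ s)
    (hσ : a ≤ σ) (t : ℝ) :
    ‖L (σ + t * I) - L (s + t * I) - (σ - s) * deriv L (s + t * I)‖ ≤
      |σ - s| / a * (deriv L (s + t * I)).re * |σ - s| := by
  have ho : IsOpen {w : ℂ | 0 < w.re} := isOpen_lt continuous_const continuous_re
  set p := deriv L (s + t * I)
  have hp : 0 < p.re := hpos _ (by simpa using ha.trans_le hs)
  have hder : ∀ x ∈ Set.uIcc s σ, HasDerivWithinAt (fun x : ℝ => L (x + t * I) - x * p)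
      (deriv L (x + t * I) - p) (Set.uIcc s σ) x := by
    intro x hx
    have hx0 : a ≤ x := (le_inf hs hσ).trans hx.1
    have hd : HasDerivAt L (deriv L (x + t * I)) (x + t * I) :=
      (hL.differentiableAt (ho.mem_nhds (by simpa using ha.trans_le hx0))).hasDerivAt
    have h1 : HasDerivAt (fun x : ℝ => (x : ℂ) + t * I) 1 x := by
      simpa using ((hasDerivAt_id x).ofReal_comp).add_const (t * I : ℂ)
    have h2 : HasDerivAt (fun x : ℝ => (x : ℂ) * p) p x := by
      simpa using ((hasDerivAt_id x).ofReal_comp).mul_const p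
    simpa using! ((hd.comp x h1).sub h2).hasDerivWithinAt
  have hbound : ∀ x ∈ Set.uIcc s σ, ‖deriv L (x + t * I) - p‖ ≤ |σ - s| / a * p.re := by
    intro x hx
    have hx0 : a ≤ x := (le_inf hs hσ).trans hx.1
    refine (norm_sub_le_of_re_pos (hL.deriv ho) hpos ha hs hx0 t).trans ?_
    have : |x - s| ≤ |σ - s| := Set.abs_sub_left_of_mem_uIcc hx
    gcongr
  have := (convex_uIcc s σ).norm_image_sub_le_of_norm_hasDerivWithin_le hder hbound
    Set.left_mem_uIcc Set.right_mem_uIcc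
  rw [Real.norm_eq_abs] at this
  have e : L (σ + t * I) - L (s + t * I) - (σ - s) * p =
      L (σ + t * I) - σ * p - (L (s + t * I) - s * p) := by ring
  rwa [e]

/-- If `Im L ≤ c` on the whole middle line, then high up the two outer lines exceed it by a fixed
`δ`. The horizontal expansions about the middle line, weighted so that their linear terms cancel,
bound this excess by a multiple of `Re L'`. So `Im L` climbs the middle line with slope bounded
below and must pass `c`. -/
theorem exists_lt_im_of_between {L : ℂ → ℂ} (hL : DifferentiableOn ℂ L {w | 0 < w.re})
    (hpos : ∀ w : ℂ, 0 < w.re → 0 < (deriv L w).re) {s₁ s₂ s₃ t₁ t₃ c : ℝ} (hs₁ : 0 < s₁)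
    (h₁₂ : s₁ < s₂) (h₂₃ : s₂ < s₃) (h₁ : c < (L (s₁ + t₁ * I)).im)
    (h₃ : c < (L (s₃ + t₃ * I)).im) : ∃ t : ℝ, c < (L (s₂ + t * I)).im := by
  by_contra! hcon
  set δ := min (L (s₁ + t₁ * I)).im (L (s₃ + t₃ * I)).im - c with hδ
  have hδpos : 0 < δ := sub_pos.mpr (lt_min h₁ h₃)
  -- Weights `s₃ - s₂` and `s₂ - s₁` make the first-order terms cancel; `C` collects the two error
  -- constants, with `s₁` as the lower bound for all abscissae.
  set C := (s₃ - s₂) * (|s₁ - s₂| / s₁ * |s₁ - s₂|) + (s₂ - s₁) * (|s₃ - s₂| / s₁ * |s₃ - s₂|)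
  have h12 : 0 < |s₁ - s₂| := abs_pos.mpr (by linarith)
  have h32 : 0 < |s₃ - s₂| := abs_pos.mpr (by linarith)
  have hC : 0 < C := by
    have := sub_pos.mpr h₁₂
    have := sub_pos.mpr h₂₃
    positivity
  set T := max t₁ t₃
  have hlow : ∀ t, T ≤ t → (s₃ - s₁) * δ / C ≤ (deriv L (s₂ + t * I)).re := by
    intro t ht
    have e1 : (L (s₁ + t₁ * I)).im ≤ (L (s₁ + t * I)).im :=
      (strictMono_im_vertical hL hpos hs₁).monotone ((le_max_left _ _).trans ht)
    have e3 : (L (s₃ + t₃ * I)).im ≤ (L (s₃ + t * I)).im :=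
      (strictMono_im_vertical hL hpos (by linarith)).monotone ((le_max_right _ _).trans ht)
    have f1 : c + δ ≤ (L (s₁ + t₁ * I)).im := by
      rw [hδ]; linarith [min_le_left (L (s₁ + t₁ * I)).im (L (s₃ + t₃ * I)).im]
    have f3 : c + δ ≤ (L (s₃ + t₃ * I)).im := by
      rw [hδ]; linarith [min_le_right (L (s₁ + t₁ * I)).im (L (s₃ + t₃ * I)).im]
    have g1 := (le_abs_self _).trans ((abs_im_le_norm _).trans
      (norm_sub_sub_le_horizontal hL hpos hs₁ h₁₂.le le_rfl t))
    have g3 := (le_abs_self _).trans ((abs_im_le_norm _).trans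
      (norm_sub_sub_le_horizontal hL hpos hs₁ h₁₂.le (h₁₂.trans h₂₃).le t))
    have g2 := hcon t
    simp only [← ofReal_sub, sub_im, im_ofReal_mul] at g1 g3
    rw [div_le_iff₀ hC]
    have k1 := mul_le_mul_of_nonneg_left g1 (sub_pos.mpr h₂₃).le
    have k3 := mul_le_mul_of_nonneg_left g3 (sub_pos.mpr h₁₂).le
    have k1' := mul_le_mul_of_nonneg_left (f1.trans e1) (sub_pos.mpr h₂₃).le
    have k3' := mul_le_mul_of_nonneg_left (f3.trans e3) (sub_pos.mpr h₁₂).le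
    have k2 := mul_le_mul_of_nonneg_left g2 (sub_pos.mpr (h₁₂.trans h₂₃)).le
    simp only [C]
    linarith
  set ε := (s₃ - s₁) * δ / C
  have hε : 0 < ε := by
    have := sub_pos.mpr (h₁₂.trans h₂₃)
    positivity
  have hs2 : 0 < s₂ := hs₁.trans h₁₂
  -- With slope at least `ε` from height `T` on, this height brings `Im L` to at least `c + ε`.
  set t := T + ((c - (L (s₂ + T * I)).im) / ε + 1)
  have hnn : 0 ≤ (c - (L (s₂ + T * I)).im) / ε := div_nonneg (sub_nonneg.mpr (hcon T)) hε.le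
  have hTt : T ≤ t := by simp only [t]; linarith
  have := (convex_Ici T).mul_sub_le_image_sub_of_le_deriv (C := ε)
    (f := fun t : ℝ => (L (s₂ + t * I)).im)
    (fun x _ => (hasDerivAt_im_vertical hL hs2 x).continuousAt.continuousWithinAt)
    (fun x _ => (hasDerivAt_im_vertical hL hs2 x).differentiableAt.differentiableWithinAt)
    (fun x hx => by
      rw [(hasDerivAt_im_vertical hL hs2 x).deriv]
      exact hlow x (interior_subset hx)) T Set.self_mem_Ici t hTt hTt
  have e : ε * (t - T) = (c - (L (s₂ + T * I)).im) + ε := by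
    simp only [t]; field_simp; ring
  have := hcon t
  linarith

/-- Reflection `conj ∘ L ∘ conj` preserves the hypotheses and flips the sign of `Im L`. -/
theorem exists_im_lt_of_between {L : ℂ → ℂ} (hL : DifferentiableOn ℂ L {w | 0 < w.re})
    (hpos : ∀ w : ℂ, 0 < w.re → 0 < (deriv L w).re) {s₁ s₂ s₃ t₁ t₃ c : ℝ} (hs₁ : 0 < s₁)
    (h₁₂ : s₁ < s₂) (h₂₃ : s₂ < s₃) (h₁ : (L (s₁ + t₁ * I)).im < c)
    (h₃ : (L (s₃ + t₃ * I)).im < c) : ∃ t : ℝ, (L (s₂ + t * I)).im < c := by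
  have ho : IsOpen {w : ℂ | 0 < w.re} := isOpen_lt continuous_const continuous_re
  have hd : ∀ w : ℂ, 0 < w.re → HasDerivAt (conj ∘ L ∘ conj) (conj (deriv L (conj w))) w := by
    intro w hw
    have : HasDerivAt L (deriv L (conj w)) (conj w) :=
      (hL.differentiableAt (ho.mem_nhds (by simpa using hw))).hasDerivAt
    simpa using this.conj_conj
  have e : ∀ s t : ℝ, ((conj ∘ L ∘ conj) (s + t * I)).im = -(L (s + (-t : ℝ) * I)).im := by
    intro s t; simp
  obtain ⟨t, ht⟩ := exists_lt_im_of_between (L := conj ∘ L ∘ conj) (c := -c) (t₁ := -t₁)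
    (t₃ := -t₃) (fun w hw => (hd w hw).differentiableAt.differentiableWithinAt)
    (fun w hw => by
      rw [(hd w hw).deriv]; simpa using hpos (conj w) (by simpa using hw)) hs₁ h₁₂ h₂₃
    (by rw [e]; simpa using h₁) (by rw [e]; simpa using h₃)
  exact ⟨-t, by rw [e] at ht; linarith⟩

/-- Moving up or down from the level points on the outer lines gives strict inequalities on both
sides of `c`; these pass to the middle line, where the intermediate value theorem applies. -/
theorem re_image_level_ordConnected {L : ℂ → ℂ} (hL : DifferentiableOn ℂ L {w | 0 < w.re})
    (hpos : ∀ w : ℂ, 0 < w.re → 0 < (deriv L w).re) (c : ℝ) :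
    {s : ℝ | 0 < s ∧ ∃ t : ℝ, (L (s + t * I)).im = c}.OrdConnected := by
  refine ⟨?_⟩
  rintro s₁ ⟨hs₁, t₁, h₁⟩ s₃ ⟨hs₃, t₃, h₃⟩ s₂ ⟨h₁₂, h₂₃⟩
  rcases h₁₂.eq_or_lt with rfl | h₁₂
  · exact ⟨hs₁, t₁, h₁⟩
  rcases h₂₃.eq_or_lt with rfl | h₂₃
  · exact ⟨hs₃, t₃, h₃⟩
  have hm1 := strictMono_im_vertical hL hpos hs₁
  have hm3 := strictMono_im_vertical hL hpos hs₃
  obtain ⟨t, ht⟩ := exists_lt_im_of_between (c := c) (t₁ := t₁ + 1) (t₃ := t₃ + 1) hL hpos hs₁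
    h₁₂ h₂₃ (h₁ ▸ hm1 (lt_add_one t₁)) (h₃ ▸ hm3 (lt_add_one t₃))
  obtain ⟨t', ht'⟩ := exists_im_lt_of_between (c := c) (t₁ := t₁ - 1) (t₃ := t₃ - 1) hL hpos hs₁
    h₁₂ h₂₃ (h₁ ▸ hm1 (sub_one_lt t₁)) (h₃ ▸ hm3 (sub_one_lt t₃))
  have hs₂ : 0 < s₂ := hs₁.trans h₁₂
  have hc : Continuous fun t : ℝ => (L (s₂ + t * I)).im :=
    continuous_iff_continuousAt.mpr fun t => (hasDerivAt_im_vertical hL hs₂ t).continuousAt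
  exact ⟨hs₂, mem_range_of_exists_le_of_exists_ge hc ⟨t', ht'.le⟩ ⟨t, ht.le⟩⟩

/-- Monotonicity on vertical lines makes the level set a graph `t = T s` over an interval, and `T`
is continuous. -/
theorem level_isPreconnected {L : ℂ → ℂ} (hL : DifferentiableOn ℂ L {w | 0 < w.re})
    (hpos : ∀ w : ℂ, 0 < w.re → 0 < (deriv L w).re) (c : ℝ) :
    IsPreconnected {w : ℂ | 0 < w.re ∧ (L w).im = c} := by
  have ho : IsOpen {w : ℂ | 0 < w.re} := isOpen_lt continuous_const continuous_re
  set J := {s : ℝ | 0 < s ∧ ∃ t : ℝ, (L (s + t * I)).im = c} with hJ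
  have hJc : IsPreconnected J := (re_image_level_ordConnected hL hpos c).isPreconnected
  choose! T hT using fun s (hs : s ∈ J) => hs.2
  have hcont : ContinuousOn T J := by
    intro s hs
    have hu : ∀ t : ℝ, ContinuousAt (fun σ : ℝ => (L (σ + t * I)).im) s := by
      intro t
      have h1 : ContinuousAt L (s + t * I) :=
        (hL.differentiableAt (ho.mem_nhds (by simpa using hs.1))).continuousAt
      have h2 : ContinuousAt (fun σ : ℝ => (σ : ℂ) + t * I) s := by fun_prop
      exact continuous_im.continuousAt.comp
        (ContinuousAt.comp (f := fun σ : ℝ => (σ : ℂ) + t * I) h1 h2)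
    have hm := strictMono_im_vertical hL hpos hs.1
    -- At a fixed height `a ≠ T s` the strict inequality between `Im L` and `c` persists for nearby
    -- abscissae, and monotonicity turns it into an inequality between `a` and `T σ`.
    refine tendsto_order.mpr ⟨fun a ha => ?_, fun a ha => ?_⟩
    · have h := (hu a).eventually_lt_const (show (L (s + a * I)).im < c from hT s hs ▸ hm ha)
      filter_upwards [self_mem_nhdsWithin, nhdsWithin_le_nhds h] with σ hσ h
      rw [← hT σ hσ] at h
      exact (strictMono_im_vertical hL hpos hσ.1).lt_iff_lt.mp h
    · have h := (hu a).eventually_const_lt (show c < (L (s + a * I)).im from hT s hs ▸ hm ha)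
      filter_upwards [self_mem_nhdsWithin, nhdsWithin_le_nhds h] with σ hσ h
      rw [← hT σ hσ] at h
      exact (strictMono_im_vertical hL hpos hσ.1).lt_iff_lt.mp h
  have himg : {w : ℂ | 0 < w.re ∧ (L w).im = c} = (fun s : ℝ => (s : ℂ) + T s * I) '' J := by
    ext w
    constructor
    · rintro ⟨hw, hc⟩
      have hmem : w.re ∈ J := ⟨hw, w.im, by rwa [re_add_im]⟩
      refine ⟨w.re, hmem, ?_⟩
      have : T w.re = w.im := (strictMono_im_vertical hL hpos hw).injective (by
        simp only [hT _ hmem, re_add_im, hc])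
      simp only [this, re_add_im]
    · rintro ⟨s, hs, rfl⟩
      exact ⟨by simpa using hs.1, hT s hs⟩
  rw [himg]
  refine hJc.image _ ?_
  have : ContinuousOn (fun s : ℝ => (T s : ℂ)) J := continuous_ofReal.comp_continuousOn hcont
  fun_prop

/-! ### Univalence of `L` and of its harmonic shear. -/

/-- The Noshiro–Warschawski theorem on the right half-plane. -/
theorem injOn_of_re_deriv_pos {L : ℂ → ℂ} (hL : DifferentiableOn ℂ L {w | 0 < w.re})
    (hpos : ∀ w : ℂ, 0 < w.re → 0 < (deriv L w).re) : Set.InjOn L {w | 0 < w.re} := by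
  have ho : IsOpen {w : ℂ | 0 < w.re} := isOpen_lt continuous_const continuous_re
  intro w₁ h₁ w₂ h₂ heq
  by_contra hne
  set d := w₂ - w₁
  have hd : 0 < normSq d := normSq_pos.mpr (sub_ne_zero.mpr (Ne.symm hne))
  have hmem : ∀ x ∈ Set.Icc (0 : ℝ) 1, 0 < (w₁ + x * d).re := by
    intro x hx
    have : (w₁ + x * d).re = (1 - x) * w₁.re + x * w₂.re := by simp [d]; ring
    rw [this]
    have h₁ : 0 < w₁.re := h₁
    have h₂ : 0 < w₂.re := h₂
    rcases hx.1.eq_or_lt with rfl | h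
    · simpa using h₁
    · nlinarith [hx.2, mul_pos h h₂, mul_nonneg (sub_nonneg.mpr hx.2) h₁.le]
  have hder : ∀ x ∈ Set.Icc (0 : ℝ) 1, HasDerivAt (fun x : ℝ => (conj d * L (w₁ + x * d)).re)
      -- Pairing with `conj d` makes the derivative along the segment `|d|² Re L'`, so the two ends
      -- cannot share a value.
      (normSq d * (deriv L (w₁ + x * d)).re) x := by
    intro x hx
    have h1 : HasDerivAt (fun x : ℝ => w₁ + (x : ℂ) * d) d x := by
      simpa using (((hasDerivAt_id x).ofReal_comp).mul_const d).const_add w₁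
    have h2 := ((hL.differentiableAt (ho.mem_nhds (hmem x hx))).hasDerivAt.comp x h1).const_mul
      (conj d)
    have h3 := (reCLM.hasFDerivAt).comp_hasDerivAt x h2
    convert! h3 using 1
    have : conj d * (deriv L (w₁ + x * d) * d) = (normSq d : ℂ) * deriv L (w₁ + x * d) := by
      rw [normSq_eq_conj_mul_self]; ring
    simp [this]
  have hmono : StrictMonoOn (fun x : ℝ => (conj d * L (w₁ + x * d)).re) (Set.Icc 0 1) :=
    strictMonoOn_of_deriv_pos (convex_Icc 0 1)
      (fun x hx => (hder x hx).continuousAt.continuousWithinAt)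
      (fun x hx => by
        have hx := interior_subset hx
        rw [(hder x hx).deriv]
        exact mul_pos hd (hpos _ (hmem x hx)))
  have := hmono (by simp : (0 : ℝ) ∈ Set.Icc 0 1) (by simp : (1 : ℝ) ∈ Set.Icc 0 1) one_pos
  simp [d, heq] at this

theorem re_add_div_sub_pos {a b : ℂ} (h : ‖b‖ < ‖a‖) : 0 < ((a + b) / (a - b)).re := by
  have hne : a - b ≠ 0 := fun h' => by
    rw [sub_eq_zero] at h'
    simp [h'] at h
  have h2 : normSq b < normSq a := by
    rw [normSq_eq_norm_sq, normSq_eq_norm_sq]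
    exact pow_lt_pow_left₀ h (norm_nonneg _) two_ne_zero
  have : ((a + b) / (a - b)).re = (normSq a - normSq b) / normSq (a - b) := by
    rw [div_re, ← add_div, normSq_apply a, normSq_apply b]
    simp only [add_re, add_im, sub_re, sub_im]
    ring
  rw [this]
  exact div_pos (by linarith) (normSq_pos.mpr hne)

theorem hasDerivAt_invFunOn {L : ℂ → ℂ} {U : Set ℂ} (hU : IsOpen U) (hL : DifferentiableOn ℂ L U)
    (hinj : Set.InjOn L U) {w : ℂ} (hw : w ∈ U) (hne : deriv L w ≠ 0) :
    HasDerivAt (Function.invFunOn L U) (deriv L w)⁻¹ (L w) := by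
  have hs : HasStrictDerivAt L (deriv L w) w :=
    ((hL.analyticAt (hU.mem_nhds hw)).hasStrictDerivAt)
  have hg := hs.to_localInverse hne
  refine hg.hasDerivAt.congr_of_eventuallyEq ?_
  have h1 := hs.eventually_right_inverse hne
  have h2 : ∀ᶠ y in nhds (L w), hs.localInverse L (deriv L w) w hne y ∈ U := by
    have := hg.hasDerivAt.continuousAt
    have e : hs.localInverse L (deriv L w) w hne (L w) = w :=
      HasStrictFDerivAt.localInverse_apply_image _
    rw [ContinuousAt, e] at this
    exact this (hU.mem_nhds hw)
  filter_upwards [h1, h2] with y hy hyU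
  have hmem : ∃ x ∈ U, L x = y := ⟨_, hyU, hy⟩
  exact hinj (Function.invFunOn_mem hmem) hyU ((Function.invFunOn_eq hmem).trans hy.symm)

theorem deriv_sub_halfPlane {A B : ℂ → ℂ} (hA : DifferentiableOn ℂ A {w | 0 < w.re})
    (hB : DifferentiableOn ℂ B {w | 0 < w.re}) {w : ℂ} (hw : 0 < w.re) :
    deriv (fun w => A w - B w) w = deriv A w - deriv B w := by
  have ho : IsOpen {w : ℂ | 0 < w.re} := isOpen_lt continuous_const continuous_re
  exact deriv_fun_sub (hA.differentiableAt (ho.mem_nhds hw)) (hB.differentiableAt (ho.mem_nhds hw))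

/-- A sense-preserving harmonic function `A + conj B` on the right half-plane with
`Re (A' - B') > 0` is univalent. -/
theorem injOn_add_conj_of_re_pos {A B : ℂ → ℂ} (hA : DifferentiableOn ℂ A {w | 0 < w.re})
    (hB : DifferentiableOn ℂ B {w | 0 < w.re})
    (hlt : ∀ w : ℂ, 0 < w.re → ‖deriv B w‖ < ‖deriv A w‖)
    (hpos : ∀ w : ℂ, 0 < w.re → 0 < (deriv A w - deriv B w).re) :
    Set.InjOn (fun w => A w + conj (B w)) {w | 0 < w.re} := by
  have ho : IsOpen {w : ℂ | 0 < w.re} := isOpen_lt continuous_const continuous_re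
  set L : ℂ → ℂ := fun w => A w - B w with hLdef
  have hL : DifferentiableOn ℂ L {w | 0 < w.re} := hA.sub hB
  have hLd : ∀ w : ℂ, 0 < w.re → deriv L w = deriv A w - deriv B w := fun w hw =>
    deriv_sub_halfPlane hA hB hw
  have hLpos : ∀ w : ℂ, 0 < w.re → 0 < (deriv L w).re := fun w hw => by
    rw [hLd w hw]; exact hpos w hw
  have hinj := injOn_of_re_deriv_pos hL hLpos
  intro w₁ h₁ w₂ h₂ heq
  set c := (L w₁).im with hc
  have hc2 : (L w₂).im = c := by
    have := congrArg im heq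
    simp only [add_im, conj_im] at this
    simp only [hc, hLdef, sub_im]
    linarith
  set E := {w : ℂ | 0 < w.re ∧ (L w).im = c} with hE
  set S : Set ℝ := (fun w => (L w).re) '' E with hS
  have hSpre : IsPreconnected S := (level_isPreconnected hL hLpos c).image _
    (continuous_re.comp_continuousOn (hL.continuousOn.mono fun w hw => hw.1))
  have hLeq : ∀ w ∈ E, (((L w).re : ℝ) : ℂ) + c * I = L w := fun w hw => by
    rw [← hw.2, re_add_im]
  -- The level set is parametrized by `x = Re L`, through the inverse of `L` on the line of height
  -- `c`.
  set g : ℝ → ℂ := fun x => Function.invFunOn L {w | 0 < w.re} (x + c * I) with hg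
  have hgL : ∀ w ∈ E, g (L w).re = w := fun w hw => by
    simp only [hg, hLeq w hw]
    exact hinj.leftInvOn_invFunOn hw.1
  -- The derivative is `Re ((A' + B') / (A' - B'))`, positive since `|B'| < |A'|`; and `Re (A + B) =
  -- Re (A + conj B)`.
  have hψ : ∀ x ∈ S, ∃ ρ > 0, HasDerivAt (fun x => (A (g x) + B (g x)).re) ρ x := by
    rintro _ ⟨w, hw, rfl⟩
    have hd := hLpos w hw.1
    have hne : deriv L w ≠ 0 := fun h => by simp [h] at hd
    have h1 := hasDerivAt_invFunOn ho hL hinj hw.1 hne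
    rw [← hLeq w hw] at h1
    have h2 : HasDerivAt (fun x : ℝ => (x : ℂ) + c * I) 1 (L w).re := by
      simpa using ((hasDerivAt_id (L w).re).ofReal_comp).add_const (c * I : ℂ)
    have h3 : HasDerivAt g (deriv L w)⁻¹ (L w).re := by
      simpa using! h1.comp (L w).re h2
    have hAB : HasDerivAt (fun w => A w + B w) (deriv A w + deriv B w) (g (L w).re) := by
      rw [hgL w hw]
      exact (hA.differentiableAt (ho.mem_nhds hw.1)).hasDerivAt.add
        (hB.differentiableAt (ho.mem_nhds hw.1)).hasDerivAt
    refine ⟨_, ?_, (reCLM.hasFDerivAt).comp_hasDerivAt _ (hAB.comp _ h3)⟩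
    have := re_add_div_sub_pos (hlt w hw.1)
    rw [← hLd w hw.1, div_eq_mul_inv] at this
    simpa using this
  have hmono : StrictMonoOn (fun x => (A (g x) + B (g x)).re) S := by
    refine strictMonoOn_of_deriv_pos hSpre.ordConnected.convex (fun x hx => ?_) (fun x hx => ?_)
    · obtain ⟨ρ, -, h⟩ := hψ x hx
      exact h.continuousAt.continuousWithinAt
    · obtain ⟨ρ, h0, h⟩ := hψ x (interior_subset hx)
      rwa [h.deriv]
  have hm1 : w₁ ∈ E := ⟨h₁, rfl⟩
  have hm2 : w₂ ∈ E := ⟨h₂, hc2⟩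
  have hre : (L w₁).re = (L w₂).re := by
    refine hmono.injOn ⟨w₁, hm1, rfl⟩ ⟨w₂, hm2, rfl⟩ ?_
    simp only [hgL w₁ hm1, hgL w₂ hm2]
    simpa using congrArg re heq
  exact hinj h₁ h₂ (Complex.ext hre hc2.symm)

theorem isPreconnected_image_level {A B : ℂ → ℂ} (hA : DifferentiableOn ℂ A {w | 0 < w.re})
    (hB : DifferentiableOn ℂ B {w | 0 < w.re})
    (hpos : ∀ w : ℂ, 0 < w.re → 0 < (deriv A w - deriv B w).re) (c : ℝ) :
    IsPreconnected ((fun w => A w + conj (B w)) '' {w | 0 < w.re ∧ (A w - B w).im = c}) := by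
  refine (level_isPreconnected (hA.sub hB) (fun w hw => ?_) c).image _ ?_
  · exact (deriv_sub_halfPlane hA hB hw) ▸ hpos w hw
  · exact ((hA.continuousOn).add (continuous_conj.comp_continuousOn hB.continuousOn)).mono
      fun w hw => hw.1

/-! ### Wirtinger derivatives, coefficients and the decomposition `h + conj g`. -/

theorem fderiv_add_conj {f h g : ℂ → ℂ} (hh : DifferentiableOn ℂ h (ball 0 1))
    (hg : DifferentiableOn ℂ g (ball 0 1))
    (hf : Set.EqOn f (fun z => h z + conj (g z)) (ball 0 1)) {z : ℂ} (hz : z ∈ ball (0 : ℂ) 1)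
    (v : ℂ) : fderiv ℝ f z v = deriv h z * v + conj (deriv g z * v) := by
  have hn := isOpen_ball.mem_nhds hz
  have h1 := (hh.differentiableAt hn).hasDerivAt.hasFDerivAt.restrictScalars ℝ
  have h2 := (hg.differentiableAt hn).hasDerivAt.hasFDerivAt.restrictScalars ℝ
  have h3 := (conjCLE.toContinuousLinearMap.hasFDerivAt (x := g z)).comp z h2
  have h4 : HasFDerivAt f _ z := (h1.add h3).congr_of_eventuallyEq
    (Filter.eventuallyEq_of_mem hn hf)
  rw [h4.fderiv]
  simp [mul_comm]

theorem dz_add_conj {f h g : ℂ → ℂ} (hh : DifferentiableOn ℂ h (ball 0 1))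
    (hg : DifferentiableOn ℂ g (ball 0 1))
    (hf : Set.EqOn f (fun z => h z + conj (g z)) (ball 0 1)) {z : ℂ} (hz : z ∈ ball (0 : ℂ) 1) :
    dz f z = deriv h z := by
  simp only [dz, fderiv_add_conj hh hg hf hz, mul_one, map_mul, conj_I]
  linear_combination (-(deriv h z) / 2 + conj (deriv g z) / 2) * I_sq

theorem dzbar_add_conj {f h g : ℂ → ℂ} (hh : DifferentiableOn ℂ h (ball 0 1))
    (hg : DifferentiableOn ℂ g (ball 0 1))
    (hf : Set.EqOn f (fun z => h z + conj (g z)) (ball 0 1)) {z : ℂ} (hz : z ∈ ball (0 : ℂ) 1) :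
    dzbar f z = conj (deriv g z) := by
  simp only [dzbar, fderiv_add_conj hh hg hf hz, mul_one, map_mul, conj_I]
  linear_combination (deriv h z / 2 - conj (deriv g z) / 2) * I_sq

theorem differentiableOn_iteratedDeriv {h : ℂ → ℂ} (hh : DifferentiableOn ℂ h (ball 0 1)) (n : ℕ) :
    DifferentiableOn ℂ (iteratedDeriv n h) (ball 0 1) := by
  induction n with
  | zero => simpa
  | succ n ih => rw [iteratedDeriv_succ]; exact ih.deriv isOpen_ball

theorem dz_iterate_add_conj {f h g : ℂ → ℂ} (hh : DifferentiableOn ℂ h (ball 0 1))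
    (hg : DifferentiableOn ℂ g (ball 0 1))
    (hf : Set.EqOn f (fun z => h z + conj (g z)) (ball 0 1)) (n : ℕ) :
    Set.EqOn (dz^[n + 1] f) (iteratedDeriv (n + 1) h) (ball 0 1) := by
  induction n with
  | zero =>
    intro z hz
    simpa [iteratedDeriv_one] using dz_add_conj hh hg hf hz
  | succ n ih =>
    intro z hz
    rw [Function.iterate_succ_apply', iteratedDeriv_succ]
    -- One application of `dz` already removes the antiholomorphic part.
    exact dz_add_conj (g := fun _ => 0) (differentiableOn_iteratedDeriv hh _)
      (differentiableOn_const 0) (fun w hw => by simpa using ih hw) hz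

theorem dzbar_iterate_add_conj {f h g : ℂ → ℂ} (hh : DifferentiableOn ℂ h (ball 0 1))
    (hg : DifferentiableOn ℂ g (ball 0 1))
    (hf : Set.EqOn f (fun z => h z + conj (g z)) (ball 0 1)) (n : ℕ) :
    Set.EqOn (dzbar^[n + 1] f) (fun z => conj (iteratedDeriv (n + 1) g z)) (ball 0 1) := by
  induction n with
  | zero =>
    intro z hz
    simpa [iteratedDeriv_one] using dzbar_add_conj hh hg hf hz
  | succ n ih =>
    intro z hz
    rw [Function.iterate_succ_apply', iteratedDeriv_succ]
    exact dzbar_add_conj (h := fun _ => 0) (differentiableOn_const 0)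
      (differentiableOn_iteratedDeriv hg _) (fun w hw => by simpa using ih hw) hz

theorem coeffA_add_conj {f h g : ℂ → ℂ} (hh : DifferentiableOn ℂ h (ball 0 1))
    (hg : DifferentiableOn ℂ g (ball 0 1))
    (hf : Set.EqOn f (fun z => h z + conj (g z)) (ball 0 1)) (n : ℕ) :
    coeffA f (n + 1) = ((n + 1).factorial : ℂ)⁻¹ * iteratedDeriv (n + 1) h 0 := by
  rw [coeffA, dz_iterate_add_conj hh hg hf n (mem_ball_self one_pos), div_eq_inv_mul]

theorem coeffB_add_conj {f h g : ℂ → ℂ} (hh : DifferentiableOn ℂ h (ball 0 1))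
    (hg : DifferentiableOn ℂ g (ball 0 1))
    (hf : Set.EqOn f (fun z => h z + conj (g z)) (ball 0 1)) (n : ℕ) :
    coeffB f (n + 1) = ((n + 1).factorial : ℂ)⁻¹ * iteratedDeriv (n + 1) g 0 := by
  rw [coeffB, dzbar_iterate_add_conj hh hg hf n (mem_ball_self one_pos), div_eq_inv_mul]
  simp

theorem hasSum_taylor_succ {h : ℂ → ℂ} (hh : DifferentiableOn ℂ h (ball 0 1)) (h0 : h 0 = 0)
    {z : ℂ} (hz : z ∈ ball (0 : ℂ) 1) :
    HasSum (fun n : ℕ => ((n + 1).factorial : ℂ)⁻¹ * iteratedDeriv (n + 1) h 0 * z ^ (n + 1))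
      (h z) := by
  have := (hasSum_nat_add_iff' 1).mpr (hasSum_taylorSeries_on_ball hh hz)
  simp only [Finset.sum_range_one, sub_zero, pow_zero, iteratedDeriv_zero, h0, smul_eq_mul,
    mul_zero] at this
  exact this.congr_fun fun n => by ring

/-- A complex-valued harmonic function on the disk is `h + conj g` with `h`, `g` holomorphic. -/
theorem exists_eqOn_add_conj {f : ℂ → ℂ}
    (hf : InnerProductSpace.HarmonicOnNhd f (ball (0 : ℂ) 1)) (h0 : f 0 = 0) :
    ∃ h g : ℂ → ℂ, DifferentiableOn ℂ h (ball 0 1) ∧ DifferentiableOn ℂ g (ball 0 1) ∧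
      h 0 = 0 ∧ g 0 = 0 ∧ Set.EqOn f (fun z => h z + conj (g z)) (ball 0 1) := by
  obtain ⟨p, hp, hpf⟩ := (hf.comp_CLM reCLM).exists_analyticOnNhd_ball_re_eq
  obtain ⟨q, hq, hqf⟩ := (hf.comp_CLM imCLM).exists_analyticOnNhd_ball_re_eq
  have hp' := hp.differentiableOn
  have hq' := hq.differentiableOn
  have key : ∀ z ∈ ball (0 : ℂ) 1,
      f z = (p z + I * q z) / 2 + conj ((p z - I * q z) / 2) := by
    intro z hz
    have h1 : (p z).re = (f z).re := hpf hz
    have h2 : (q z).re = (f z).im := hqf hz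
    have hc : conj (2 : ℂ) = 2 := map_ofNat _ 2
    rw [map_div₀, hc]
    apply Complex.ext
    · simp; linarith
    · simp; linarith
  have k0 := key 0 (mem_ball_self one_pos)
  rw [h0] at k0
  refine ⟨fun z => (p z + I * q z) / 2 - (p 0 + I * q 0) / 2,
    fun z => (p z - I * q z) / 2 - (p 0 - I * q 0) / 2, by fun_prop, by fun_prop, by simp,
    by simp, fun z hz => ?_⟩
  rw [key z hz]
  beta_reduce
  rw [map_sub (starRingEnd ℂ) ((p z - I * q z) / 2)]
  linear_combination -k0

/-! ### Power series with multiplied coefficients. -/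

/-- At radius `√r` both series converge absolutely, and the diagonal of their product family is the
series at radius `r`. -/
theorem summable_norm_mul_mul_pow {a b : ℕ → ℂ}
    (ha : ∀ z ∈ ball (0 : ℂ) 1, Summable fun n => a n * z ^ (n + 1))
    (hb : ∀ z ∈ ball (0 : ℂ) 1, Summable fun n => b n * z ^ (n + 1)) {r : ℝ} (hr0 : 0 ≤ r)
    (hr : r < 1) : Summable fun n => ‖a n * b n‖ * r ^ (n + 1) := by
  have hmem : ((√r : ℝ) : ℂ) ∈ ball (0 : ℂ) 1 := by
    rw [mem_ball_zero_iff, norm_real, Real.norm_of_nonneg (Real.sqrt_nonneg _)]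
    exact (Real.sqrt_lt' one_pos).mpr (by simpa)
  have := ((ha _ hmem).norm.mul_of_nonneg (hb _ hmem).norm (fun _ => norm_nonneg _)
    (fun _ => norm_nonneg _)).comp_injective (i := fun n : ℕ => (n, n))
    fun m n h => congrArg Prod.fst h
  refine this.congr fun n => ?_
  have e : (√r) ^ (n + 1) * (√r) ^ (n + 1) = r ^ (n + 1) := by
    rw [← mul_pow, Real.mul_self_sqrt hr0]
  simp only [Function.comp_apply, norm_mul, norm_pow, norm_real,
    Real.norm_of_nonneg (Real.sqrt_nonneg r)]
  rw [← e]
  ring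

theorem summable_mul_mul_pow {a b : ℕ → ℂ}
    (ha : ∀ z ∈ ball (0 : ℂ) 1, Summable fun n => a n * z ^ (n + 1))
    (hb : ∀ z ∈ ball (0 : ℂ) 1, Summable fun n => b n * z ^ (n + 1)) {z : ℂ}
    (hz : z ∈ ball (0 : ℂ) 1) : Summable fun n => a n * b n * z ^ (n + 1) :=
  Summable.of_norm ((summable_norm_mul_mul_pow ha hb (norm_nonneg z)
    (mem_ball_zero_iff.mp hz)).congr fun n => by rw [norm_mul _ (z ^ _), norm_pow])

theorem differentiableOn_tsum_mul_mul_pow {a b : ℕ → ℂ}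
    (ha : ∀ z ∈ ball (0 : ℂ) 1, Summable fun n => a n * z ^ (n + 1))
    (hb : ∀ z ∈ ball (0 : ℂ) 1, Summable fun n => b n * z ^ (n + 1)) :
    DifferentiableOn ℂ (fun z => ∑' n, a n * b n * z ^ (n + 1)) (ball 0 1) := by
  intro z hz
  obtain ⟨r, hzr, hr⟩ := exists_between (mem_ball_zero_iff.mp hz)
  refine ((differentiableOn_tsum_of_summable_norm
    (summable_norm_mul_mul_pow ha hb ((norm_nonneg z).trans hzr.le) hr)
    (fun n => by fun_prop) isOpen_ball (fun n w hw => ?_)).differentiableAt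
    (isOpen_ball.mem_nhds (mem_ball_zero_iff.mpr hzr))).differentiableWithinAt
  rw [norm_mul, norm_pow]
  have := (mem_ball_zero_iff.mp hw).le
  gcongr

theorem deriv_tsum_mul_mul_pow_zero {a b : ℕ → ℂ}
    (ha : ∀ z ∈ ball (0 : ℂ) 1, Summable fun n => a n * z ^ (n + 1))
    (hb : ∀ z ∈ ball (0 : ℂ) 1, Summable fun n => b n * z ^ (n + 1)) :
    deriv (fun z => ∑' n, a n * b n * z ^ (n + 1)) 0 = a 0 * b 0 := by
  have h := hasSum_deriv_of_summable_norm (F := fun n z => a n * b n * z ^ (n + 1))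
    (summable_norm_mul_mul_pow ha hb (r := 1 / 2) (by norm_num) (by norm_num))
    (fun n => by fun_prop) (isOpen_ball (x := (0 : ℂ)) (ε := 1 / 2)) (fun n w hw => by
      rw [norm_mul, norm_pow]
      have := (mem_ball_zero_iff.mp hw).le
      gcongr) (mem_ball_self (by norm_num : (0 : ℝ) < 1 / 2))
  refine h.unique ?_
  have h0 := hasSum_single (f := fun n => deriv (fun z : ℂ => a n * b n * z ^ (n + 1)) 0) 0
    fun n hn => by simp [hn]
  simpa using h0

theorem eq_of_hasSum_pow {a b : ℕ → ℂ} {F : ℂ → ℂ}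
    (ha : ∀ z ∈ ball (0 : ℂ) 1, HasSum (fun n => a n * z ^ n) (F z))
    (hb : ∀ z ∈ ball (0 : ℂ) 1, HasSum (fun n => b n * z ^ n) (F z)) (n : ℕ) : a n = b n := by
  have key : ∀ c : ℕ → ℂ, (∀ z ∈ ball (0 : ℂ) 1, HasSum (fun n => c n * z ^ n) (F z)) →
      HasFPowerSeriesAt F (FormalMultilinearSeries.ofScalars ℂ c) 0 := by
    intro c hc
    rw [hasFPowerSeriesAt_iff]
    filter_upwards [ball_mem_nhds (0 : ℂ) one_pos] with z hz
    simpa [mul_comm] using hc z hz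
  have := congrArg (fun p => p.coeff n) ((key a ha).eq_formalMultilinearSeries (key b hb))
  simpa using this

theorem harmonicOnNhd_add_conj {h g : ℂ → ℂ} (hh : DifferentiableOn ℂ h (ball 0 1))
    (hg : DifferentiableOn ℂ g (ball 0 1)) :
    InnerProductSpace.HarmonicOnNhd (fun z => h z + conj (g z)) (ball 0 1) := by
  intro z hz
  have hn := isOpen_ball.mem_nhds hz
  exact (hh.analyticAt hn).harmonicAt.add
    ((hg.analyticAt hn).harmonicAt.comp_CLM conjCLE.toContinuousLinearMap)

/-! ### Rigidity of half-plane maps and the convolution identity. -/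

theorem mul_mem_unitBall {c z : ℂ} (hc : ‖c‖ = 1) (hz : z ∈ ball (0 : ℂ) 1) :
    c * z ∈ ball (0 : ℂ) 1 := by
  rw [mem_ball_zero_iff] at hz ⊢
  rwa [norm_mul, hc, one_mul]

theorem one_sub_ne_zero_of_mem_ball {z : ℂ} (hz : z ∈ ball (0 : ℂ) 1) : 1 - z ≠ 0 := fun h => by
  have : z = 1 := (sub_eq_zero.mp h).symm
  simp [this] at hz

theorem conj_inv_of_norm_eq_one {c : ℂ} (hc : ‖c‖ = 1) : conj c⁻¹ = c := by
  rw [inv_def, normSq_eq_norm_sq, hc]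
  simp

/-- A holomorphic map of the disk into the half-plane `Re w > -1/2` that fixes `0` and has
derivative of modulus one there is a rotated half-plane map. -/
theorem eq_div_one_sub_of_re_gt {F : ℂ → ℂ} (hF : DifferentiableOn ℂ F (ball 0 1)) (h0 : F 0 = 0)
    (hre : ∀ z ∈ ball (0 : ℂ) 1, -(1 / 2 : ℝ) < (F z).re) (h1 : ‖deriv F 0‖ = 1) {z : ℂ}
    (hz : z ∈ ball (0 : ℂ) 1) : F z = deriv F 0 * z / (1 - deriv F 0 * z) := by
  have hne : ∀ z ∈ ball (0 : ℂ) 1, 1 + F z ≠ 0 := fun z hz h => by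
    have h2 := congrArg re h
    have h3 := hre z hz
    simp at h2
    linarith
  have hω : DifferentiableOn ℂ (fun z => F z / (1 + F z)) (ball 0 1) :=
    hF.div (hF.const_add 1) hne
  -- `w ↦ w / (1 + w)` takes `Re w > -1/2` into the unit disk and fixes `0` with derivative one.
  have hmaps : Set.MapsTo (fun z => F z / (1 + F z)) (ball 0 1)
      (closedBall ((fun z => F z / (1 + F z)) 0) 1) := by
    intro z hz
    have h3 := hre z hz
    simp only [h0, zero_div, mem_closedBall_zero_iff, norm_div]
    refine (div_le_one (norm_pos_iff.mpr (hne z hz))).mpr ?_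
    apply le_of_sq_le_sq _ (norm_nonneg _)
    rw [← normSq_eq_norm_sq, ← normSq_eq_norm_sq, normSq_apply, normSq_apply]
    simp
    nlinarith
  have hd0 : HasDerivAt F (deriv F 0) 0 :=
    (hF.differentiableAt (ball_mem_nhds 0 one_pos)).hasDerivAt
  have hder : deriv (fun z => F z / (1 + F z)) 0 = deriv F 0 := by
    have := (hd0.fun_div (hd0.const_add 1) (by simp [h0])).deriv
    simpa [h0] using this
  -- Equality case of the Schwarz lemma.
  have haff := affine_of_mapsTo_ball_of_norm_dslope_eq_div hω hmaps (mem_ball_self one_pos)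
    (by rw [dslope_same, hder, h1, div_one])
  have hz' := haff hz
  simp only [h0, zero_div, dslope_same, hder, sub_zero, zero_add, smul_eq_mul] at hz'
  have h2 := hne z hz
  have h3 : 1 - deriv F 0 * z ≠ 0 := one_sub_ne_zero_of_mem_ball (mul_mem_unitBall h1 hz)
  rw [div_eq_iff h2] at hz'
  rw [eq_div_iff h3]
  linear_combination hz'

theorem hasSum_half_plane_map {c z : ℂ} (hc : ‖c‖ = 1) (hz : z ∈ ball (0 : ℂ) 1) :
    HasSum (fun n : ℕ => c ^ (n + 1) * z ^ (n + 1)) (c * z / (1 - c * z)) := by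
  have h := (hasSum_geometric_of_norm_lt_one
    (mem_ball_zero_iff.mp (mul_mem_unitBall hc hz))).mul_left (c * z)
  rw [← div_eq_mul_inv] at h
  exact h.congr_fun fun n => by ring

theorem eq_of_hasSum_pow_succ {a b : ℕ → ℂ} {F : ℂ → ℂ}
    (ha : ∀ z ∈ ball (0 : ℂ) 1, HasSum (fun n => a n * z ^ (n + 1)) (F z))
    (hb : ∀ z ∈ ball (0 : ℂ) 1, HasSum (fun n => b n * z ^ (n + 1)) (F z)) (n : ℕ) :
    a n = b n := by
  have key : ∀ c : ℕ → ℂ, (∀ z ∈ ball (0 : ℂ) 1, HasSum (fun n => c n * z ^ (n + 1)) (F z)) →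
      ∀ z ∈ ball (0 : ℂ) 1, HasSum (fun n => (Nat.casesOn n 0 c : ℂ) * z ^ n) (F z) := by
    intro c hc z hz
    rw [← hasSum_nat_add_iff' 1]
    simpa using hc z hz
  simpa using eq_of_hasSum_pow (key a ha) (key b hb) (n + 1)

/-- Holomorphic and antiholomorphic parts of a harmonic map of the disk into a slanted
half-plane. -/
theorem IsSHOOnto.exists_parts {γ : ℝ} {f : ℂ → ℂ} (hf : IsSHOOnto γ f) :
    ∃ h g : ℂ → ℂ, DifferentiableOn ℂ h (ball 0 1) ∧ DifferentiableOn ℂ g (ball 0 1) ∧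
      (∀ z ∈ ball (0 : ℂ) 1, ‖deriv g z‖ < ‖deriv h z‖) ∧
      (∀ z ∈ ball (0 : ℂ) 1, HasSum (fun n => coeffA f (n + 1) * z ^ (n + 1)) (h z)) ∧
      (∀ z ∈ ball (0 : ℂ) 1, HasSum (fun n => coeffB f (n + 1) * z ^ (n + 1)) (g z)) ∧
      ∀ z ∈ ball (0 : ℂ) 1, exp (I * γ) * h z + (exp (I * γ))⁻¹ * g z =
        exp (I * γ) * z / (1 - exp (I * γ) * z) := by
  obtain ⟨hS, himg⟩ := hf
  obtain ⟨h, g, hh, hg, h0, g0, hfe⟩ := exists_eqOn_add_conj hS.harmonic hS.map_zero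
  set c := exp (I * γ) with hc
  have hc1 : ‖c‖ = 1 := by rw [hc, mul_comm]; exact norm_exp_ofReal_mul_I γ
  have m0 : (0 : ℂ) ∈ ball (0 : ℂ) 1 := mem_ball_self one_pos
  refine ⟨h, g, hh, hg, fun z hz => ?_, fun z hz => ?_, fun z hz => ?_, fun z hz => ?_⟩
  · have := hS.sensePreserving z hz
    rwa [dz_add_conj hh hg hfe hz, dzbar_add_conj hh hg hfe hz, RCLike.norm_conj] at this
  · simp only [coeffA_add_conj hh hg hfe]
    exact hasSum_taylor_succ hh h0 hz
  · simp only [coeffB_add_conj hh hg hfe]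
    exact hasSum_taylor_succ hg g0 hz
  · have hd : deriv (fun z => c * h z + c⁻¹ * g z) 0 = c := by
      have e1 := dz_add_conj hh hg hfe m0
      have e2 := dzbar_add_conj hh hg hfe m0
      rw [hS.dz_zero] at e1
      rw [hS.dzbar_zero, eq_comm, map_eq_zero] at e2
      have d1 := (hh.differentiableAt (ball_mem_nhds 0 one_pos)).hasDerivAt.const_mul c
      have d2 := (hg.differentiableAt (ball_mem_nhds 0 one_pos)).hasDerivAt.const_mul c⁻¹
      rw [(d1.fun_add d2).deriv, ← e1, e2]
      simp
    have := eq_div_one_sub_of_re_gt (F := fun z => c * h z + c⁻¹ * g z)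
      ((hh.const_mul c).add (hg.const_mul c⁻¹)) (by simp [h0, g0]) (fun w hw => ?_)
      (by rw [hd, hc1]) hz
    · rwa [hd] at this
    · have hmem : f w ∈ slantedHalfPlane γ := himg ▸ Set.mem_image_of_mem f hw
      have hmem : -(1 / 2 : ℝ) < (c * f w).re := hmem
      rw [hfe hw] at hmem
      -- This lets the analytic function `c h + c⁻¹ g` inherit the half-plane condition from `c f`.
      have e : (c * conj (g w)).re = (c⁻¹ * g w).re := by
        rw [← conj_re (c⁻¹ * g w), map_mul, conj_inv_of_norm_eq_one hc1]
      simpa only [mul_add, add_re, e] using hmem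

/-- Differentiating `hsum` gives `c h' + c⁻¹ g' = c / (1 - cz)²`, so the expression is the quotient
of `c h' - c⁻¹ g'` by `c h' + c⁻¹ g'`. -/
theorem re_deriv_mul_sq_pos {c : ℂ} (hc : ‖c‖ = 1) {h g : ℂ → ℂ}
    (hh : DifferentiableOn ℂ h (ball 0 1)) (hg : DifferentiableOn ℂ g (ball 0 1))
    (hlt : ∀ z ∈ ball (0 : ℂ) 1, ‖deriv g z‖ < ‖deriv h z‖)
    (hsum : ∀ z ∈ ball (0 : ℂ) 1, c * h z + c⁻¹ * g z = c * z / (1 - c * z)) {z : ℂ}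
    (hz : z ∈ ball (0 : ℂ) 1) :
    0 < ((c * deriv h z - c⁻¹ * deriv g z) * (c⁻¹ * (1 - c * z) ^ 2)).re := by
  have hn := isOpen_ball.mem_nhds hz
  have hc0 : c ≠ 0 := fun h => by simp [h] at hc
  have hne : 1 - c * z ≠ 0 := one_sub_ne_zero_of_mem_ball (mul_mem_unitBall hc hz)
  have d1 := ((hh.differentiableAt hn).hasDerivAt.const_mul c).fun_add
    ((hg.differentiableAt hn).hasDerivAt.const_mul c⁻¹)
  have dn : HasDerivAt (fun z => c * z) c z := by simpa using (hasDerivAt_id z).const_mul c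
  have d2 := (dn.fun_div (dn.const_sub 1) hne).congr_of_eventuallyEq
    (Filter.eventuallyEq_of_mem hn hsum)
  have e := d1.unique d2
  have e' : c * deriv h z + c⁻¹ * deriv g z = c / (1 - c * z) ^ 2 := by
    rw [e]; congr 1; ring
  have hpos := re_add_div_sub_pos (a := c * deriv h z) (b := -(c⁻¹ * deriv g z)) (by
    simpa [hc] using hlt z hz)
  rw [sub_neg_eq_add, e', ← sub_eq_add_neg] at hpos
  convert hpos using 2
  field_simp

/-- Coefficientwise this is `2(AA' - BB') = (A + B)(A' - B') + (A - B)(A' + B')`, where the sums `A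
+ B` are the powers `c_k ^ (n + 1)` and act as rotations of the variable. -/
theorem hasSum_mul_sub_mul {c₁ c₂ : ℂ} (hc₁ : ‖c₁‖ = 1) (hc₂ : ‖c₂‖ = 1)
    {a₁ b₁ a₂ b₂ : ℕ → ℂ} {h₁ g₁ h₂ g₂ : ℂ → ℂ}
    (ha₁ : ∀ z ∈ ball (0 : ℂ) 1, HasSum (fun n => a₁ n * z ^ (n + 1)) (h₁ z))
    (hb₁ : ∀ z ∈ ball (0 : ℂ) 1, HasSum (fun n => b₁ n * z ^ (n + 1)) (g₁ z))
    (ha₂ : ∀ z ∈ ball (0 : ℂ) 1, HasSum (fun n => a₂ n * z ^ (n + 1)) (h₂ z))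
    (hb₂ : ∀ z ∈ ball (0 : ℂ) 1, HasSum (fun n => b₂ n * z ^ (n + 1)) (g₂ z))
    (hs₁ : ∀ z ∈ ball (0 : ℂ) 1, c₁ * h₁ z + c₁⁻¹ * g₁ z = c₁ * z / (1 - c₁ * z))
    (hs₂ : ∀ z ∈ ball (0 : ℂ) 1, c₂ * h₂ z + c₂⁻¹ * g₂ z = c₂ * z / (1 - c₂ * z)) {z : ℂ}
    (hz : z ∈ ball (0 : ℂ) 1) :
    c₁ * c₂ * (∑' n, a₁ n * a₂ n * z ^ (n + 1)) -
        (c₁ * c₂)⁻¹ * (∑' n, b₁ n * b₂ n * z ^ (n + 1)) =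
      ((c₂ * h₂ (c₁ * z) - c₂⁻¹ * g₂ (c₁ * z)) + (c₁ * h₁ (c₂ * z) - c₁⁻¹ * g₁ (c₂ * z))) / 2 := by
  have k₁ : ∀ n, c₁ * a₁ n + c₁⁻¹ * b₁ n = c₁ ^ (n + 1) := eq_of_hasSum_pow_succ
    (F := fun z => c₁ * h₁ z + c₁⁻¹ * g₁ z)
    (fun z hz => (((ha₁ z hz).mul_left c₁).add ((hb₁ z hz).mul_left c₁⁻¹)).congr_fun
      fun n => by ring)
    (fun z hz => hs₁ z hz ▸ hasSum_half_plane_map hc₁ hz)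
  have k₂ : ∀ n, c₂ * a₂ n + c₂⁻¹ * b₂ n = c₂ ^ (n + 1) := eq_of_hasSum_pow_succ
    (F := fun z => c₂ * h₂ z + c₂⁻¹ * g₂ z)
    (fun z hz => (((ha₂ z hz).mul_left c₂).add ((hb₂ z hz).mul_left c₂⁻¹)).congr_fun
      fun n => by ring)
    (fun z hz => hs₂ z hz ▸ hasSum_half_plane_map hc₂ hz)
  have m₁ := mul_mem_unitBall hc₁ hz
  have m₂ := mul_mem_unitBall hc₂ hz
  have hL := ((summable_mul_mul_pow (fun z hz => (ha₁ z hz).summable)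
    (fun z hz => (ha₂ z hz).summable) hz).hasSum.mul_left (c₁ * c₂)).sub
    ((summable_mul_mul_pow (fun z hz => (hb₁ z hz).summable)
    (fun z hz => (hb₂ z hz).summable) hz).hasSum.mul_left (c₁ * c₂)⁻¹)
  have hR := ((((ha₂ _ m₁).mul_left c₂).sub ((hb₂ _ m₁).mul_left c₂⁻¹)).add
    (((ha₁ _ m₂).mul_left c₁).sub ((hb₁ _ m₂).mul_left c₁⁻¹))).div_const 2
  refine hL.unique (hR.congr_fun fun n => ?_)
  rw [mul_pow, mul_pow, ← k₁, ← k₂, mul_inv]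
  ring

/-! ### Transfer between disk and half-plane. -/

theorem re_pos_add_one_ne_zero {w : ℂ} (hw : 0 < w.re) : w + 1 ≠ 0 := fun h => by
  have := congrArg re h
  simp at this
  linarith

theorem cayley_mem_unitBall {c w : ℂ} (hc : ‖c‖ = 1) (hw : 0 < w.re) :
    c⁻¹ * ((w - 1) / (w + 1)) ∈ ball (0 : ℂ) 1 := by
  rw [mem_ball_zero_iff, norm_mul, norm_inv, hc, inv_one, one_mul]
  simpa using norm_sub_div_add_conj_lt_one (p := w) (q := 1) hw (by simp)

theorem exists_cayley_eq {c z : ℂ} (hc : ‖c‖ = 1) (hz : z ∈ ball (0 : ℂ) 1) :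
    ∃ w : ℂ, 0 < w.re ∧ c⁻¹ * ((w - 1) / (w + 1)) = z := by
  have hc0 : c ≠ 0 := fun h => by simp [h] at hc
  have hm := mul_mem_unitBall hc hz
  have hne := one_sub_ne_zero_of_mem_ball hm
  have hw : 0 < ((1 + c * z) / (1 - c * z)).re := by
    simpa using cayley_re_pos one_pos 0 (mem_ball_zero_iff.mp hm)
  have h1 := re_pos_add_one_ne_zero hw
  refine ⟨_, hw, ?_⟩
  rw [inv_mul_eq_iff_eq_mul₀ hc0, div_eq_iff h1]
  field_simp
  ring

theorem hasDerivAt_cayley {c w : ℂ} (hw : 0 < w.re) :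
    HasDerivAt (fun w => c⁻¹ * ((w - 1) / (w + 1))) (c⁻¹ * (2 / (w + 1) ^ 2)) w := by
  have h1 := re_pos_add_one_ne_zero hw
  have := ((((hasDerivAt_id' w).sub_const 1).fun_div ((hasDerivAt_id' w).add_const 1)
    h1).const_mul c⁻¹)
  convert! this using 2
  ring

section

variable {c : ℂ} {H G : ℂ → ℂ}

theorem differentiableOn_comp_cayley (hc : ‖c‖ = 1) (hH : DifferentiableOn ℂ H (ball 0 1)) :
    DifferentiableOn ℂ (fun w => H (c⁻¹ * ((w - 1) / (w + 1)))) {w | 0 < w.re} :=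
  hH.comp (fun _ hw => (hasDerivAt_cayley hw).differentiableAt.differentiableWithinAt)
    fun _ hw => cayley_mem_unitBall hc hw

theorem deriv_const_mul_comp_cayley (hc : ‖c‖ = 1) (hH : DifferentiableOn ℂ H (ball 0 1)) (b : ℂ)
    {w : ℂ} (hw : 0 < w.re) :
    deriv (fun w => b * H (c⁻¹ * ((w - 1) / (w + 1)))) w =
      b * (deriv H (c⁻¹ * ((w - 1) / (w + 1))) * (c⁻¹ * (2 / (w + 1) ^ 2))) :=
  (((hH.differentiableAt (isOpen_ball.mem_nhds (cayley_mem_unitBall hc hw))).hasDerivAt.comp w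
    (hasDerivAt_cayley hw)).const_mul b).deriv

theorem norm_deriv_comp_cayley_lt (hc : ‖c‖ = 1) (hH : DifferentiableOn ℂ H (ball 0 1))
    (hG : DifferentiableOn ℂ G (ball 0 1))
    (hlt : ∀ z ∈ ball (0 : ℂ) 1, ‖deriv G z‖ < ‖deriv H z‖) {w : ℂ} (hw : 0 < w.re) :
    ‖deriv (fun w => c⁻¹ * G (c⁻¹ * ((w - 1) / (w + 1)))) w‖ <
      ‖deriv (fun w => c * H (c⁻¹ * ((w - 1) / (w + 1)))) w‖ := by
  rw [deriv_const_mul_comp_cayley hc hG _ hw, deriv_const_mul_comp_cayley hc hH _ hw]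
  have h1 := re_pos_add_one_ne_zero hw
  have hpos : 0 < ‖c⁻¹ * (2 / (w + 1) ^ 2)‖ := norm_pos_iff.mpr
    (mul_ne_zero (inv_ne_zero fun h => by simp [h] at hc)
      (div_ne_zero two_ne_zero (pow_ne_zero 2 h1)))
  rw [norm_mul, norm_mul _ (c⁻¹ * _), norm_mul c, norm_mul _ (c⁻¹ * _), norm_inv, hc, inv_one,
    one_mul, one_mul]
  exact mul_lt_mul_of_pos_right (hlt _ (cayley_mem_unitBall hc hw)) hpos

/-- With `1 - cz = 2/(w + 1)`, the derivative of the substitution is `c⁻¹(1 - cz)² / 2`, exactly the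
weight in `hpos` up to a positive factor. -/
theorem re_deriv_comp_cayley_pos (hc : ‖c‖ = 1) (hH : DifferentiableOn ℂ H (ball 0 1))
    (hG : DifferentiableOn ℂ G (ball 0 1))
    (hpos : ∀ z ∈ ball (0 : ℂ) 1,
      0 < ((c * deriv H z - c⁻¹ * deriv G z) * (c⁻¹ * (1 - c * z) ^ 2)).re) {w : ℂ}
    (hw : 0 < w.re) :
    0 < (deriv (fun w => c * H (c⁻¹ * ((w - 1) / (w + 1)))) w -
      deriv (fun w => c⁻¹ * G (c⁻¹ * ((w - 1) / (w + 1)))) w).re := by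
  rw [deriv_const_mul_comp_cayley hc hG _ hw, deriv_const_mul_comp_cayley hc hH _ hw]
  have hc0 : c ≠ 0 := fun h => by simp [h] at hc
  have h1 := re_pos_add_one_ne_zero hw
  have h := hpos _ (cayley_mem_unitBall hc hw)
  have e : 1 - c * (c⁻¹ * ((w - 1) / (w + 1))) = 2 / (w + 1) := by
    field_simp
    ring
  rw [e] at h
  set z := c⁻¹ * ((w - 1) / (w + 1))
  have e' : c * (deriv H z * (c⁻¹ * (2 / (w + 1) ^ 2))) -
      c⁻¹ * (deriv G z * (c⁻¹ * (2 / (w + 1) ^ 2))) =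
      ((1 / 2 : ℝ) : ℂ) * ((c * deriv H z - c⁻¹ * deriv G z) * (c⁻¹ * (2 / (w + 1)) ^ 2)) := by
    rw [div_pow]
    push_cast
    ring
  rw [e', re_ofReal_mul]
  linarith

end

/-- A sense-preserving harmonic function `H + conj G` on the disk for which
`Re (c⁻¹ (1 - c z)² (c H' - c⁻¹ G')) > 0` is univalent. -/
theorem injOn_disk_of_re_pos {c : ℂ} {H G f : ℂ → ℂ} (hc : ‖c‖ = 1)
    (hH : DifferentiableOn ℂ H (ball 0 1)) (hG : DifferentiableOn ℂ G (ball 0 1))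
    (hf : Set.EqOn f (fun z => H z + conj (G z)) (ball 0 1))
    (hlt : ∀ z ∈ ball (0 : ℂ) 1, ‖deriv G z‖ < ‖deriv H z‖)
    (hpos : ∀ z ∈ ball (0 : ℂ) 1,
      0 < ((c * deriv H z - c⁻¹ * deriv G z) * (c⁻¹ * (1 - c * z) ^ 2)).re) :
    Set.InjOn f (ball 0 1) := by
  intro z₁ hz₁ z₂ hz₂ heq
  rw [hf hz₁, hf hz₂] at heq
  obtain ⟨w₁, hw₁, rfl⟩ := exists_cayley_eq hc hz₁
  obtain ⟨w₂, hw₂, rfl⟩ := exists_cayley_eq hc hz₂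
  have := injOn_add_conj_of_re_pos ((differentiableOn_comp_cayley hc hH).const_mul c)
    ((differentiableOn_comp_cayley hc hG).const_mul c⁻¹)
    (fun w hw => norm_deriv_comp_cayley_lt hc hH hG hlt hw)
    (fun w hw => re_deriv_comp_cayley_pos hc hH hG hpos hw) hw₁ hw₂ (by
      simp only [map_mul, conj_inv_of_norm_eq_one hc, ← mul_add]
      exact congrArg (c * ·) heq)
  rw [this]

/-- Multiplication by `c` makes lines of direction `c⁻¹` horizontal, and horizontal slices of `c f`
come from level sets of `Im (A - B)`. -/
theorem convexInDirection_of_re_pos {c : ℂ} {H G f : ℂ → ℂ} {θ : ℝ} (hc : ‖c‖ = 1)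
    (hθ : exp (I * θ) = c⁻¹)
    (hH : DifferentiableOn ℂ H (ball 0 1)) (hG : DifferentiableOn ℂ G (ball 0 1))
    (hf : Set.EqOn f (fun z => H z + conj (G z)) (ball 0 1))
    (hpos : ∀ z ∈ ball (0 : ℂ) 1,
      0 < ((c * deriv H z - c⁻¹ * deriv G z) * (c⁻¹ * (1 - c * z) ^ 2)).re) :
    ConvexInDirection θ (f '' ball 0 1) := by
  intro v
  have hc0 : c ≠ 0 := fun h => by simp [h] at hc
  set A : ℂ → ℂ := fun w => c * H (c⁻¹ * ((w - 1) / (w + 1))) with hA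
  set B : ℂ → ℂ := fun w => c⁻¹ * G (c⁻¹ * ((w - 1) / (w + 1))) with hB
  have hAB : ∀ w : ℂ, 0 < w.re → A w + conj (B w) = c * f (c⁻¹ * ((w - 1) / (w + 1))) := by
    intro w hw
    rw [hf (cayley_mem_unitBall hc hw)]
    simp only [hA, hB, map_mul, conj_inv_of_norm_eq_one hc, ← mul_add]
  have him : ∀ w : ℂ, (A w - B w).im = (A w + conj (B w)).im := fun w => by simp; ring
  have hpre := isPreconnected_image_level ((differentiableOn_comp_cayley hc hH).const_mul c)
    ((differentiableOn_comp_cayley hc hG).const_mul c⁻¹)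
    (fun w hw => re_deriv_comp_cayley_pos hc hH hG hpos hw) (c * v).im
  convert hpre.image (fun x => c⁻¹ * x) (by fun_prop) using 1
  rw [hθ]
  ext x
  constructor
  · rintro ⟨⟨z, hz, rfl⟩, t, ht⟩
    obtain ⟨w, hw, rfl⟩ := exists_cayley_eq hc hz
    have ht : v + t * c⁻¹ = f (c⁻¹ * ((w - 1) / (w + 1))) := ht
    refine ⟨A w + conj (B w), ⟨w, ⟨hw, ?_⟩, rfl⟩, ?_⟩
    · change (A w - B w).im = _
      rw [him, hAB w hw, ← ht, mul_add, mul_left_comm, mul_inv_cancel₀ hc0]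
      simp
    · rw [hAB w hw]
      exact inv_mul_cancel_left₀ hc0 _
  · rintro ⟨_, ⟨w, ⟨hw, hwc⟩, rfl⟩, rfl⟩
    have hwc : (A w - B w).im = (c * v).im := hwc
    have e : c⁻¹ * (A w + conj (B w)) = f (c⁻¹ * ((w - 1) / (w + 1))) := by
      rw [hAB w hw, inv_mul_cancel_left₀ hc0]
    refine ⟨⟨_, cayley_mem_unitBall hc hw, e.symm⟩, (A w + conj (B w) - c * v).re, ?_⟩
    have e2 : (((A w + conj (B w) - c * v).re : ℝ) : ℂ) = A w + conj (B w) - c * v := by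
      apply Complex.ext
      · simp
      · rw [ofReal_im, sub_im, ← him, hwc, sub_self]
    change v + (((A w + conj (B w) - c * v).re : ℝ) : ℂ) * c⁻¹ = c⁻¹ * (A w + conj (B w))
    rw [e2]
    linear_combination -v * mul_inv_cancel₀ hc0

/-! ### Positivity for the convolution, and the theorem. -/

theorem re_deriv_conv_pos {c₁ c₂ : ℂ} (hc₁ : ‖c₁‖ = 1) (hc₂ : ‖c₂‖ = 1)
    {H G h₁ g₁ h₂ g₂ : ℂ → ℂ}
    (hH : DifferentiableOn ℂ H (ball 0 1)) (hG : DifferentiableOn ℂ G (ball 0 1))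
    (dh₁ : DifferentiableOn ℂ h₁ (ball 0 1)) (dg₁ : DifferentiableOn ℂ g₁ (ball 0 1))
    (dh₂ : DifferentiableOn ℂ h₂ (ball 0 1)) (dg₂ : DifferentiableOn ℂ g₂ (ball 0 1))
    (hlt₁ : ∀ z ∈ ball (0 : ℂ) 1, ‖deriv g₁ z‖ < ‖deriv h₁ z‖)
    (hlt₂ : ∀ z ∈ ball (0 : ℂ) 1, ‖deriv g₂ z‖ < ‖deriv h₂ z‖)
    (hs₁ : ∀ z ∈ ball (0 : ℂ) 1, c₁ * h₁ z + c₁⁻¹ * g₁ z = c₁ * z / (1 - c₁ * z))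
    (hs₂ : ∀ z ∈ ball (0 : ℂ) 1, c₂ * h₂ z + c₂⁻¹ * g₂ z = c₂ * z / (1 - c₂ * z))
    (hconv : ∀ z ∈ ball (0 : ℂ) 1, c₁ * c₂ * H z - (c₁ * c₂)⁻¹ * G z =
      ((c₂ * h₂ (c₁ * z) - c₂⁻¹ * g₂ (c₁ * z)) + (c₁ * h₁ (c₂ * z) - c₁⁻¹ * g₁ (c₂ * z))) / 2)
    {z : ℂ} (hz : z ∈ ball (0 : ℂ) 1) :
    0 < ((c₁ * c₂ * deriv H z - (c₁ * c₂)⁻¹ * deriv G z) *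
      ((c₁ * c₂)⁻¹ * (1 - c₁ * c₂ * z) ^ 2)).re := by
  have hn := isOpen_ball.mem_nhds hz
  have m₁ := mul_mem_unitBall hc₁ hz
  have m₂ := mul_mem_unitBall hc₂ hz
  have n₁ : c₁ ≠ 0 := fun h => by simp [h] at hc₁
  have n₂ : c₂ ≠ 0 := fun h => by simp [h] at hc₂
  have rot : ∀ c : ℂ, HasDerivAt (fun z => c * z) c z := fun c => by
    simpa using (hasDerivAt_id z).const_mul c
  have dc : ∀ (F : ℂ → ℂ) (c : ℂ), DifferentiableOn ℂ F (ball 0 1) → c * z ∈ ball (0 : ℂ) 1 →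
      HasDerivAt (fun z => F (c * z)) (deriv F (c * z) * c) z := fun F c hF hm =>
    (hF.differentiableAt (isOpen_ball.mem_nhds hm)).hasDerivAt.comp z (rot c)
  have d1 := ((hH.differentiableAt hn).hasDerivAt.const_mul (c₁ * c₂)).fun_sub
    ((hG.differentiableAt hn).hasDerivAt.const_mul (c₁ * c₂)⁻¹)
  have d2 := (((((dc h₂ c₁ dh₂ m₁).const_mul c₂).fun_sub ((dc g₂ c₁ dg₂ m₁).const_mul c₂⁻¹)).fun_add
    (((dc h₁ c₂ dh₁ m₂).const_mul c₁).fun_sub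
      ((dc g₁ c₂ dg₁ m₂).const_mul c₁⁻¹))).div_const 2).congr_of_eventuallyEq
    (Filter.eventuallyEq_of_mem hn hconv)
  have p₁ := re_deriv_mul_sq_pos hc₁ dh₁ dg₁ hlt₁ hs₁ m₂
  have p₂ := re_deriv_mul_sq_pos hc₂ dh₂ dg₂ hlt₂ hs₂ m₁
  have e : (c₁ * c₂ * deriv H z - (c₁ * c₂)⁻¹ * deriv G z) *
      ((c₁ * c₂)⁻¹ * (1 - c₁ * c₂ * z) ^ 2) = ((1 / 2 : ℝ) : ℂ) *
      ((c₂ * deriv h₂ (c₁ * z) - c₂⁻¹ * deriv g₂ (c₁ * z)) * (c₂⁻¹ * (1 - c₂ * (c₁ * z)) ^ 2) +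
       (c₁ * deriv h₁ (c₂ * z) - c₁⁻¹ * deriv g₁ (c₂ * z)) *
        (c₁⁻¹ * (1 - c₁ * (c₂ * z)) ^ 2)) := by
    -- The chain-rule factor of each rotation cancels one of `c₁`, `c₂`, and both weights become `(1
    -- - c₁c₂z)²`, so the two positive real parts add.
    rw [d1.unique d2]
    push_cast
    field_simp
  rw [e, re_ofReal_mul, add_re]
  linarith

end HarmonicMaps

open HarmonicMaps in
theorem theorem2 (γ₁ γ₂ : ℝ) (f₁ f₂ : ℂ → ℂ)
    (hf₁ : HarmonicMaps.IsSHOOnto γ₁ f₁) (hf₂ : HarmonicMaps.IsSHOOnto γ₂ f₂)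
    (hloc : HarmonicMaps.LocallyUnivalent (HarmonicMaps.harmonicConv f₁ f₂)) :
    HarmonicMaps.IsSHO (HarmonicMaps.harmonicConv f₁ f₂) ∧
      HarmonicMaps.ConvexInDirection (-(γ₁ + γ₂))
        (HarmonicMaps.harmonicConv f₁ f₂ '' ball (0 : ℂ) 1) := by
  obtain ⟨h₁, g₁, dh₁, dg₁, hlt₁, ha₁, hb₁, hs₁⟩ := hf₁.exists_parts
  obtain ⟨h₂, g₂, dh₂, dg₂, hlt₂, ha₂, hb₂, hs₂⟩ := hf₂.exists_parts
  set c₁ := exp (I * γ₁) with hc₁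
  set c₂ := exp (I * γ₂) with hc₂
  have nc₁ : ‖c₁‖ = 1 := by rw [hc₁, mul_comm]; exact norm_exp_ofReal_mul_I γ₁
  have nc₂ : ‖c₂‖ = 1 := by rw [hc₂, mul_comm]; exact norm_exp_ofReal_mul_I γ₂
  have nc : ‖c₁ * c₂‖ = 1 := by rw [norm_mul, nc₁, nc₂, one_mul]
  have hθ : exp (I * ((-(γ₁ + γ₂) : ℝ) : ℂ)) = (c₁ * c₂)⁻¹ := by
    rw [hc₁, hc₂, ← exp_add, ← exp_neg]
    congr 1
    push_cast
    ring
  set H : ℂ → ℂ := fun z => ∑' n : ℕ, coeffA f₁ (n + 1) * coeffA f₂ (n + 1) * z ^ (n + 1)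
  set G : ℂ → ℂ := fun z => ∑' n : ℕ, coeffB f₁ (n + 1) * coeffB f₂ (n + 1) * z ^ (n + 1)
  have sa₁ := fun z hz => (ha₁ z hz).summable
  have sa₂ := fun z hz => (ha₂ z hz).summable
  have sb₁ := fun z hz => (hb₁ z hz).summable
  have sb₂ := fun z hz => (hb₂ z hz).summable
  have hH : DifferentiableOn ℂ H (ball 0 1) := differentiableOn_tsum_mul_mul_pow sa₁ sa₂
  have hG : DifferentiableOn ℂ G (ball 0 1) := differentiableOn_tsum_mul_mul_pow sb₁ sb₂
  have hf : Set.EqOn (harmonicConv f₁ f₂) (fun z => H z + conj (G z)) (ball 0 1) :=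
    fun z _ => rfl
  have hlt : ∀ z ∈ ball (0 : ℂ) 1, ‖deriv G z‖ < ‖deriv H z‖ := fun z hz => by
    have := hloc z hz
    rwa [dz_add_conj hH hG hf hz, dzbar_add_conj hH hG hf hz, RCLike.norm_conj] at this
  have hpos : ∀ z ∈ ball (0 : ℂ) 1, 0 < ((c₁ * c₂ * deriv H z - (c₁ * c₂)⁻¹ * deriv G z) *
      ((c₁ * c₂)⁻¹ * (1 - c₁ * c₂ * z) ^ 2)).re := fun z hz =>
    re_deriv_conv_pos nc₁ nc₂ hH hG dh₁ dg₁ dh₂ dg₂ hlt₁ hlt₂ hs₁ hs₂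
      (fun z hz => hasSum_mul_sub_mul nc₁ nc₂ ha₁ hb₁ ha₂ hb₂ hs₁ hs₂ hz) hz
  have m0 : (0 : ℂ) ∈ ball (0 : ℂ) 1 := mem_ball_self one_pos
  refine ⟨⟨harmonicOnNhd_add_conj hH hG, hloc, injOn_disk_of_re_pos nc hH hG hf hlt hpos, ?_, ?_,
    ?_⟩, convexInDirection_of_re_pos nc hθ hH hG hf hpos⟩
  · simp [harmonicConv]
  · rw [dz_add_conj hH hG hf m0, deriv_tsum_mul_mul_pow_zero sa₁ sa₂]
    simp [coeffA, hf₁.1.dz_zero, hf₂.1.dz_zero]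
  · rw [dzbar_add_conj hH hG hf m0, deriv_tsum_mul_mul_pow_zero sb₁ sb₂]
    simp [coeffB, hf₁.1.dzbar_zero]
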